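/- Let $n,m\ge 0$ be integers. Let $\mathcal E_{n+m}$ be the set of real symmetric positive semidefinite $(n+m)\times(n+m)$ matrices with all diagonal entries equal to $1$, and let $\pi$ be the map sending a block matrix $\begin{pmatrix}A&C\\ C^{\mathsf T}&B\end{pmatrix}$, with $A$ of size $n\times n$ and $B$ of size $m\times m$, to its $n\times m$ block $C$. A tensor product representation of local dimension $d$ of a matrix $C=(c_{ij})\in\mathbb R^{n\times m}$ consists of Hermitian matrices $M_1,\dots,M_n,N_1,\dots,N_m\in\mathbb C^{d\times d}$ and a Hermitian positive semidefinite matrix $\rho\in\mathbb C^{d^2\times d^2}$ such that $M_i^2\preceq I$, $N_j^2\preceq I$, $\mathrm{Tr}(\rho)=1$ and $c_{ij}=\mathrm{Tr}\big((M_i\otimes N_j)\rho\big)$ for all $i\in\{1,\dots,n\}$, $j\in\{1,\dots,m\}$. **Theorem.** If $C$ is an extreme point of the convex set $\pi(\mathcal E_{n+m})$, then every tensor product representation of $C$ has local dimension $$d\ \ge\ 2^{\lfloor \mathrm{rank}(C)/2\rfloor}.$$ -/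

import Mathlib

open scoped Kronecker ComplexOrder

/-- The elliptope: real symmetric positive semidefinite matrices with unit diagonal
(the correlation matrices), indexed by a finite type. -/
def elliptope (ι : Type) [Fintype ι] : Set (Matrix ι ι ℝ) :=
  {E | E.PosSemidef ∧ ∀ i, E i i = 1}

/-- The `(n, m)` bipartite correlation matrices: the image of the elliptope of size `n + m`
under the projection of a block matrix `(A C; Cᵀ B)` to its upper right block `C`. -/
def bipartiteCorrelations (n m : ℕ) : Set (Matrix (Fin n) (Fin m) ℝ) :=
  (fun E : Matrix (Fin n ⊕ Fin m) (Fin n ⊕ Fin m) ℝ => E.toBlocks₁₂) ''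
    elliptope (Fin n ⊕ Fin m)

/-- The Hermitian matrices `M i`, `N j` (observables on `ℂ^d` with spectrum in `[-1, 1]`) and
`ρ` (a state on `ℂ^d ⊗ ℂ^d`) form a tensor product representation of `C`
with local dimension `d`. -/
structure IsTensorProductRepresentation {n m d : ℕ} (C : Matrix (Fin n) (Fin m) ℝ)
    (M : Fin n → Matrix (Fin d) (Fin d) ℂ) (N : Fin m → Matrix (Fin d) (Fin d) ℂ)
    (ρ : Matrix (Fin d × Fin d) (Fin d × Fin d) ℂ) : Prop where
  isHermitian_left : ∀ i, (M i).IsHermitian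
  isHermitian_right : ∀ j, (N j).IsHermitian
  sq_left_le_one : ∀ i, (1 - M i ^ 2).PosSemidef
  sq_right_le_one : ∀ j, (1 - N j ^ 2).PosSemidef
  state_posSemidef : ρ.PosSemidef
  state_trace : ρ.trace = 1
  correlation : ∀ i j, (C i j : ℂ) = ((M i ⊗ₖ N j) * ρ).trace

/-!
Write `ρ = R Rᴴ`. In the real Hilbert–Schmidt space the vectors `x i = (M i ⊗ 1) R` and
`y j = (1 ⊗ N j) R` have norm at most `1` and inner products `C i j`. Extremality of `C ≠ 0` makes
this configuration rigid:

* all the vectors have norm exactly `1` (`IsVectorRealization.norm_eq_one`), which means that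
  `(M i ⊗ 1)²` and `(1 ⊗ N j)²` fix `R`;
* each family lies in the span of the other (`inr_mem_span`, `inl_mem_span`), so the common span
  `S`, of dimension at least `rank C`, is reached both by left operators, `s = (X s ⊗ 1) R`, and
  by right operators, `s = (1 ⊗ Y s) R`;
* a symmetric bilinear form on `S` with zero diagonal at every `x i` and `y j` vanishes on all pairs
  `(x i, y j)` (`bilin_eq_zero`), since otherwise it would perturb the Gram matrix, and with it `C`,
  in both directions.

Since left and right operators commute, `(X s)² ⊗ 1` fixes `R` for `s` any `x i` or `y j`. The last
point then upgrades this to `(X s X t + X t X s) ⊗ 1 = 2 ⟪s, t⟫` on `R` for all `s`, `t` in `S`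
(`leftAction_clifford_eq_zero`). Because `(X s ⊗ 1) R = (1 ⊗ Y s) R`, the operators `X s` preserve
the support of `ρ` on the first factor `ℂ^d`. This nonzero space of dimension at most `d` is
therefore a module over a complex Clifford algebra with at least `rank C` generators, and such
modules have dimension at least `2 ^ ⌊rank C / 2⌋`
(`two_pow_le_finrank_of_anticommuting_involutions`).
-/

open scoped InnerProductSpace

/-! ### Anticommuting involutions -/

/-- On the `1`-eigenspace `W` of the first involution `a`, the remaining generators, multiplied by
`i b` for the second involution `b`, again form a family of anticommuting involutions. Since `b`
moves `W` to a complement of itself, the dimension at least doubles with each pair of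
generators. -/
theorem two_pow_le_finrank_of_anticommuting_involutions (k : ℕ) :
    ∀ (V : Type) [AddCommGroup V] [Module ℂ V] [FiniteDimensional ℂ V] [Nontrivial V]
      (e : Fin (2 * k) → Module.End ℂ V) (_ : ∀ i v, e i (e i v) = v)
      (_ : ∀ i j, i ≠ j → ∀ v, e i (e j v) = -e j (e i v)),
      2 ^ k ≤ Module.finrank ℂ V := by
  induction k with
  | zero =>
    intro V _ _ _ _ e _ _
    simpa using Nat.succ_le_of_lt (Module.finrank_pos (R := ℂ) (M := V))
  | succ k ih =>
    intro V _ _ _ _ e hsq hanti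
    let e' : Fin (2 * k + 2) → Module.End ℂ V := e
    have hsq' : ∀ i v, e' i (e' i v) = v := hsq
    have hanti' : ∀ i j, i ≠ j → ∀ v, e' i (e' j v) = -e' j (e' i v) := hanti
    let a := e' 0
    let b := e' 1
    let c : Fin (2 * k) → Module.End ℂ V := fun i => e' i.succ.succ
    have h01 : (0 : Fin (2 * k + 2)) ≠ 1 := by simp
    have ha : ∀ v, a (a v) = v := hsq' 0
    have hb : ∀ v, b (b v) = v := hsq' 1
    have hab : ∀ v, a (b v) = -b (a v) := hanti' 0 1 h01
    have hac : ∀ i v, a (c i v) = -c i (a v) := fun i => hanti' 0 _ (Fin.succ_ne_zero _).symm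
    have hbc : ∀ i v, b (c i v) = -c i (b v) := fun i => by
      refine hanti' 1 _ fun h => ?_
      rw [← Fin.succ_zero_eq_one] at h
      exact Fin.succ_ne_zero _ (Fin.succ_injective _ h).symm
    have hcc : ∀ i v, c i (c i v) = v := fun i => hsq' _
    have hcd : ∀ i j, i ≠ j → ∀ v, c i (c j v) = -c j (c i v) := fun i j hij =>
      hanti' _ _ fun h => hij (Fin.succ_injective _ (Fin.succ_injective _ h))
    let W : Submodule ℂ V := LinearMap.eqLocus a LinearMap.id
    have hW : ∀ v, v ∈ W ↔ a v = v := fun v => Iff.rfl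
    have hWnt : Nontrivial W := by
      obtain ⟨v, hv⟩ := exists_ne (0 : V)
      by_cases h : v + a v = 0
      · have hav : a v = -v := (neg_eq_of_add_eq_zero_right h).symm
        refine ⟨⟨⟨b v, ?_⟩, 0, fun h0 => hv ?_⟩⟩
        · rw [hW, hab, hav, map_neg, neg_neg]
        · have : b v = 0 := congrArg Subtype.val h0
          rw [← hb v, this, map_zero]
      · refine ⟨⟨⟨v + a v, ?_⟩, 0, fun h0 => h (congrArg Subtype.val h0)⟩⟩
        rw [hW, map_add, ha, add_comm]
    have hdisj : Disjoint W (W.map b) := by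
      rw [Submodule.disjoint_def]
      rintro _ h1 ⟨w, hw, rfl⟩
      have hw' : a w = w := hw
      rw [hW, hab, hw'] at h1
      have h2 : (2 : ℂ) • b w = 0 := by rw [two_smul, ← neg_add_cancel (b w), h1]
      exact (smul_eq_zero.mp h2).resolve_left two_ne_zero
    have hbinj : Function.Injective b := fun u v h => by rw [← hb u, h, hb]
    have hdim := Submodule.finrank_add_finrank_le_of_disjoint hdisj
    rw [← (Submodule.equivMapOfInjective b hbinj W).finrank_eq] at hdim
    let f : Fin (2 * k) → Module.End ℂ W := fun i =>
      (Complex.I • (b ∘ₗ c i)).restrict (p := W) (q := W) (fun w hw => by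
        have hw' : a w = w := hw
        rw [hW]
        simp [hab, hac, hw'])
    have hf : ∀ i w, (f i w : V) = Complex.I • b (c i w) := fun i w => rfl
    have key := ih W f
      (fun i w => Subtype.ext (by
        simp only [hf, map_smul, hbc, hcc, map_neg, hb, smul_neg, smul_smul]
        simp))
      (fun i j hij w => Subtype.ext (by
        simp only [hf, Submodule.coe_neg, map_smul, hbc, map_neg, hb, smul_neg, smul_smul]
        simp [hcd i j hij]))
    rw [pow_succ]
    omega

/-! ### Vector realizations of bipartite correlations -/

/-- The vectors `z` of norm at most `1`, split into a left and a right family, have `C` as their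
matrix of inner products. -/
structure IsVectorRealization {n m : ℕ} {H : Type*} [NormedAddCommGroup H] [InnerProductSpace ℝ H]
    (C : Matrix (Fin n) (Fin m) ℝ) (z : Fin n ⊕ Fin m → H) : Prop where
  norm_le_one : ∀ k, ‖z k‖ ≤ 1
  inner_eq : ∀ i j, ⟪z (.inl i), z (.inr j)⟫_ℝ = C i j

/-- Diagonal entries below `1` can be raised to `1` without changing the off-diagonal block. -/
theorem Matrix.PosSemidef.toBlocks₁₂_mem_bipartiteCorrelations {n m : ℕ}
    {E : Matrix (Fin n ⊕ Fin m) (Fin n ⊕ Fin m) ℝ} (hE : E.PosSemidef) (hdiag : ∀ k, E k k ≤ 1) :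
    E.toBlocks₁₂ ∈ bipartiteCorrelations n m := by
  refine ⟨E + Matrix.diagonal fun k => 1 - E k k,
    ⟨hE.add (Matrix.PosSemidef.diagonal fun k => sub_nonneg.mpr (hdiag k)), fun k => by simp⟩, ?_⟩
  ext i j
  simp [Matrix.toBlocks₁₂]

theorem eq_zero_of_add_mem_of_sub_mem {E : Type*} [AddCommGroup E] [Module ℝ E] {K : Set E}
    {C D : E} (hC : C ∈ K.extremePoints ℝ) (hadd : C + D ∈ K) (hsub : C - D ∈ K) : D = 0 := by
  have h := ((mem_extremePoints.mp hC).2 _ hadd _ hsub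
    ⟨1 / 2, 1 / 2, by norm_num, by norm_num, by norm_num, by module⟩).1
  simpa using h

namespace IsVectorRealization

variable {n m : ℕ} {H : Type*} [NormedAddCommGroup H] [InnerProductSpace ℝ H]
  {C : Matrix (Fin n) (Fin m) ℝ} {z : Fin n ⊕ Fin m → H}

theorem mem_bipartiteCorrelations (hz : IsVectorRealization C z) :
    C ∈ bipartiteCorrelations n m := by
  have h := (Matrix.posSemidef_gram ℝ z).toBlocks₁₂_mem_bipartiteCorrelations fun k => by
    rw [Matrix.gram_apply, real_inner_self_eq_norm_sq]
    exact pow_le_one₀ (norm_nonneg _) (hz.norm_le_one k)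
  convert h using 1
  ext i j
  simp [Matrix.toBlocks₁₂, Matrix.gram_apply, hz.inner_eq]

/-- A vector shorter than `1` could be moved in both directions along any vector of the other
family, so that extremality would force the other family to vanish. -/
theorem norm_eq_one (hz : IsVectorRealization C z)
    (hC : C ∈ (bipartiteCorrelations n m).extremePoints ℝ) (hC0 : C ≠ 0) (k : Fin n ⊕ Fin m) :
    ‖z k‖ = 1 := by
  by_contra hne
  have hlt : ‖z k‖ < 1 := lt_of_le_of_ne (hz.norm_le_one k) hne
  have hε : 0 < 1 - ‖z k‖ := by linarith
  set ε := 1 - ‖z k‖ with hεdef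
  have hnorm : ∀ (s : ℝ) (l : Fin n ⊕ Fin m), |s| = 1 → ∀ p,
      ‖Function.update z k (z k + (s * ε) • z l) p‖ ≤ 1 := by
    intro s l hs p
    by_cases hp : p = k
    · subst hp
      rw [Function.update_self]
      calc _ ≤ ‖z p‖ + ‖(s * ε) • z l‖ := norm_add_le _ _
        _ = ‖z p‖ + ε * ‖z l‖ := by rw [norm_smul, Real.norm_eq_abs, abs_mul, hs, abs_of_pos hε,
              one_mul]
        _ ≤ ‖z p‖ + ε * 1 := by gcongr; exact hz.norm_le_one l
        _ = 1 := by rw [hεdef]; ring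
    · rw [Function.update_of_ne hp]
      exact hz.norm_le_one p
  apply hC0
  cases k with
  | inr j =>
    have hx : ∀ i, z (.inl i) = 0 := by
      intro i
      let D : Matrix (Fin n) (Fin m) ℝ :=
        Matrix.of fun i' j' => if j' = j then ε * ⟪z (.inl i'), z (.inl i)⟫_ℝ else 0
      have hmem : ∀ s : ℝ, |s| = 1 → C + s • D ∈ bipartiteCorrelations n m := by
        intro s hs
        refine mem_bipartiteCorrelations
          (z := Function.update z (.inr j) (z (.inr j) + (s * ε) • z (.inl i)))
          ⟨hnorm s _ hs, fun i' j' => ?_⟩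
        by_cases hj : j' = j
        · subst hj
          simp [D, inner_add_right, inner_smul_right, hz.inner_eq, mul_assoc]
        · simp [D, hj, hz.inner_eq]
      have hD : D = 0 := eq_zero_of_add_mem_of_sub_mem hC (by simpa using hmem 1 (by simp))
        (by simpa [sub_eq_add_neg] using hmem (-1) (by simp))
      have h := congrFun (congrFun hD i) j
      simpa [D, hε.ne'] using h
    ext i j'
    simp [← hz.inner_eq, hx]
  | inl i =>
    have hy : ∀ j, z (.inr j) = 0 := by
      intro j
      let D : Matrix (Fin n) (Fin m) ℝ :=
        Matrix.of fun i' j' => if i' = i then ε * ⟪z (.inr j), z (.inr j')⟫_ℝ else 0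
      have hmem : ∀ s : ℝ, |s| = 1 → C + s • D ∈ bipartiteCorrelations n m := by
        intro s hs
        refine mem_bipartiteCorrelations
          (z := Function.update z (.inl i) (z (.inl i) + (s * ε) • z (.inr j)))
          ⟨hnorm s _ hs, fun i' j' => ?_⟩
        by_cases hj : i' = i
        · subst hj
          simp [D, inner_add_left, inner_smul_left, hz.inner_eq, mul_assoc]
        · simp [D, hj, hz.inner_eq]
      have hD : D = 0 := eq_zero_of_add_mem_of_sub_mem hC (by simpa using hmem 1 (by simp))
        (by simpa [sub_eq_add_neg] using hmem (-1) (by simp))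
      have h := congrFun (congrFun hD i) j
      simpa [D, hε.ne'] using h
    ext i' j
    simp [← hz.inner_eq, hy]

/-- Projecting the right family onto the span of the left family gives another realization, whose
vectors must again have norm `1`; hence the projection does not change them. -/
theorem inr_mem_span [FiniteDimensional ℝ H] (hz : IsVectorRealization C z)
    (hC : C ∈ (bipartiteCorrelations n m).extremePoints ℝ) (hC0 : C ≠ 0) (j : Fin m) :
    z (.inr j) ∈ Submodule.span ℝ (Set.range fun i => z (.inl i)) := by
  set U := Submodule.span ℝ (Set.range fun i => z (.inl i))
  have hU : ∀ i, z (.inl i) ∈ U := fun i => Submodule.subset_span ⟨i, rfl⟩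
  have hz' : IsVectorRealization C
      (Sum.elim (fun i => z (.inl i)) fun j => U.starProjection (z (.inr j))) := by
    refine ⟨?_, fun i j => ?_⟩
    · rintro (i | j)
      · exact hz.norm_le_one _
      · exact (U.norm_starProjection_apply_le _).trans (hz.norm_le_one _)
    · simp only [Sum.elim_inl, Sum.elim_inr]
      rw [← U.inner_starProjection_left_eq_right, U.starProjection_eq_self_iff.mpr (hU i),
        hz.inner_eq]
  rw [U.mem_iff_norm_starProjection, hz.norm_eq_one hC hC0]
  exact hz'.norm_eq_one hC hC0 (.inr j)

theorem inl_mem_span [FiniteDimensional ℝ H] (hz : IsVectorRealization C z)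
    (hC : C ∈ (bipartiteCorrelations n m).extremePoints ℝ) (hC0 : C ≠ 0) (i : Fin n) :
    z (.inl i) ∈ Submodule.span ℝ (Set.range fun j => z (.inr j)) := by
  set U := Submodule.span ℝ (Set.range fun j => z (.inr j))
  have hU : ∀ j, z (.inr j) ∈ U := fun j => Submodule.subset_span ⟨j, rfl⟩
  have hz' : IsVectorRealization C
      (Sum.elim (fun i => U.starProjection (z (.inl i))) fun j => z (.inr j)) := by
    refine ⟨?_, fun i j => ?_⟩
    · rintro (i | j)
      · exact (U.norm_starProjection_apply_le _).trans (hz.norm_le_one _)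
      · exact hz.norm_le_one _
    · simp only [Sum.elim_inl, Sum.elim_inr]
      rw [U.inner_starProjection_left_eq_right, U.starProjection_eq_self_iff.mpr (hU j),
        hz.inner_eq]
  rw [U.mem_iff_norm_starProjection, hz.norm_eq_one hC hC0]
  exact hz'.norm_eq_one hC hC0 (.inl i)

/-- For small `ε` the form `⟪u, v⟫ ± ε b u v` is positive semidefinite and still gives every `z k`
norm `1`, so its values on pairs `z (inl i)`, `z (inr j)` are again bipartite correlations. -/
theorem bilin_eq_zero [FiniteDimensional ℝ H] (hz : IsVectorRealization C z)
    (hC : C ∈ (bipartiteCorrelations n m).extremePoints ℝ) (b : LinearMap.BilinForm ℝ H)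
    (hsymm : ∀ u v, b u v = b v u) (hb : ∀ k, b (z k) (z k) = 0) (i : Fin n) (j : Fin m) :
    b (z (.inl i)) (z (.inr j)) = 0 := by
  let B := LinearMap.toContinuousBilinearMap b
  have hB : ∀ u, |b u u| ≤ ‖B‖ * ‖u‖ ^ 2 := fun u => by
    have := B.le_opNorm₂ u u
    rw [Real.norm_eq_abs] at this
    calc |b u u| ≤ ‖B‖ * ‖u‖ * ‖u‖ := this
      _ = _ := by ring
  set ε : ℝ := (‖B‖ + 1)⁻¹ with hε
  have hpos : 0 < ‖B‖ + 1 := by positivity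
  have hεpos : 0 < ε := inv_pos.mpr hpos
  let D : Matrix (Fin n ⊕ Fin m) (Fin n ⊕ Fin m) ℝ := Matrix.of fun k l => ε * b (z k) (z l)
  have hquad : ∀ c : Fin n ⊕ Fin m → ℝ,
      star c ⬝ᵥ D.mulVec c = ε * b (∑ k, c k • z k) (∑ k, c k • z k) := by
    intro c
    simp only [dotProduct, Matrix.mulVec, D, Matrix.of_apply, map_sum, LinearMap.sum_apply,
      map_smul, LinearMap.smul_apply, smul_eq_mul, Finset.mul_sum, Pi.star_apply, star_trivial]
    rw [Finset.sum_comm]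
    exact Finset.sum_congr rfl fun k _ => Finset.sum_congr rfl fun l _ => by ring
  have hmem : ∀ s : ℝ, |s| = 1 → C + s • D.toBlocks₁₂ ∈ bipartiteCorrelations n m := by
    intro s hs
    have hpsd : (Matrix.gram ℝ z + s • D).PosSemidef := by
      refine Matrix.PosSemidef.of_dotProduct_mulVec_nonneg ?_ fun c => ?_
      · refine (Matrix.isHermitian_gram ℝ z).add (Matrix.IsHermitian.ext fun k l => ?_)
        simp [D, hsymm (z k) (z l)]
      · rw [Matrix.add_mulVec, dotProduct_add, Matrix.star_dotProduct_gram_mulVec,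
          Matrix.smul_mulVec, dotProduct_smul, hquad, real_inner_self_eq_norm_sq, smul_eq_mul]
        set u := ∑ k, c k • z k
        have h1 : |s * (ε * b u u)| ≤ ‖u‖ ^ 2 := by
          rw [abs_mul, hs, one_mul, abs_mul, abs_of_pos hεpos, hε, inv_mul_le_iff₀ hpos]
          nlinarith [hB u, sq_nonneg ‖u‖]
        linarith [(abs_le.mp h1).1]
    have h := hpsd.toBlocks₁₂_mem_bipartiteCorrelations fun k => by
      simpa [D, hb, Matrix.gram_apply] using hz.norm_le_one k
    convert h using 1
    ext i j
    simp [Matrix.toBlocks₁₂, Matrix.gram_apply, hz.inner_eq]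
  have hD := eq_zero_of_add_mem_of_sub_mem hC (by simpa using hmem 1 (by simp))
    (by simpa [sub_eq_add_neg] using hmem (-1) (by simp))
  have h := congrFun (congrFun hD i) j
  simpa [D, Matrix.toBlocks₁₂, hεpos.ne'] using h

theorem rank_le_finrank_span (hz : IsVectorRealization C z) :
    C.rank ≤ Module.finrank ℝ (Submodule.span ℝ (Set.range z)) := by
  set S := Submodule.span ℝ (Set.range z)
  have : FiniteDimensional ℝ S := FiniteDimensional.span_of_finite ℝ (Set.finite_range z)
  let f : S →ₗ[ℝ] (Fin n → ℝ) :=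
    LinearMap.pi fun i => (innerₗ H (z (.inl i))) ∘ₗ S.subtype
  refine le_trans (Submodule.finrank_mono ?_) f.finrank_range_le
  rintro _ ⟨c, rfl⟩
  refine ⟨∑ j, c j • ⟨z (.inr j), Submodule.subset_span ⟨_, rfl⟩⟩, ?_⟩
  ext i
  simp [f, Matrix.mulVec, dotProduct, hz.inner_eq, mul_comm]

end IsVectorRealization

/-! ### Matrices as vectors -/

theorem Matrix.PosSemidef.exists_conjTranspose_mul_self {p : Type*} [Fintype p]
    {A : Matrix p p ℂ} (hA : A.PosSemidef) : ∃ K : Matrix p p ℂ, K.conjTranspose * K = A := by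
  classical
  open scoped MatrixOrder in
  obtain ⟨K, hK⟩ := CStarAlgebra.nonneg_iff_eq_star_mul_self.mp hA.nonneg
  exact ⟨K, hK.symm⟩

/-- Complex square matrices as vectors of the real inner product space underlying the
Hilbert–Schmidt space, with `⟪A, B⟫ = Re Tr(Aᴴ B)`. -/
noncomputable def hilbertSchmidtVec (p : Type*) :
    Matrix p p ℂ →ₗ[ℝ] EuclideanSpace ℂ (p × p) where
  toFun A := WithLp.toLp 2 A.vec
  map_add' _ _ := rfl
  map_smul' _ _ := rfl

theorem hilbertSchmidtVec_injective (p : Type*) : Function.Injective (hilbertSchmidtVec p) :=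
  fun _ _ h => Matrix.vec_inj.mp (congrArg WithLp.ofLp h)

section HilbertSchmidt

variable {p : Type*} [Fintype p]

theorem inner_hilbertSchmidtVec (A B : Matrix p p ℂ) :
    ⟪hilbertSchmidtVec p A, hilbertSchmidtVec p B⟫_ℝ = (A.conjTranspose * B).trace.re := by
  rw [← Matrix.star_vec_dotProduct_vec, PiLp.inner_apply, dotProduct, Complex.re_sum]
  refine Finset.sum_congr rfl fun x _ => ?_
  rw [Complex.inner, Pi.star_apply, mul_comm]
  rfl

variable [DecidableEq p] {T R : Matrix p p ℂ}

/-- With `1 - T² = Kᴴ K`, this is `‖T R‖² + ‖K R‖² = ‖R‖² = 1`. -/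
theorem exists_norm_sq_hilbertSchmidtVec_mul (hT : T.IsHermitian) (hT1 : (1 - T ^ 2).PosSemidef)
    (hR : (R * R.conjTranspose).trace = 1) :
    ∃ K : Matrix p p ℂ, K.conjTranspose * K = 1 - T ^ 2 ∧
      ‖hilbertSchmidtVec p (T * R)‖ ^ 2 + ‖hilbertSchmidtVec p (K * R)‖ ^ 2 = 1 := by
  obtain ⟨K, hK⟩ := hT1.exists_conjTranspose_mul_self
  refine ⟨K, hK, ?_⟩
  rw [← real_inner_self_eq_norm_sq, ← real_inner_self_eq_norm_sq, inner_hilbertSchmidtVec,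
    inner_hilbertSchmidtVec, ← Complex.add_re, ← Matrix.trace_add]
  have h : (T * R).conjTranspose * (T * R) + (K * R).conjTranspose * (K * R)
      = R.conjTranspose * R := by
    rw [Matrix.conjTranspose_mul, Matrix.conjTranspose_mul, hT.eq]
    calc _ = R.conjTranspose * (T ^ 2 + K.conjTranspose * K) * R := by noncomm_ring
      _ = _ := by rw [hK]; noncomm_ring
  rw [h, Matrix.trace_mul_comm, hR, Complex.one_re]

theorem norm_hilbertSchmidtVec_mul_le_one (hT : T.IsHermitian) (hT1 : (1 - T ^ 2).PosSemidef)
    (hR : (R * R.conjTranspose).trace = 1) : ‖hilbertSchmidtVec p (T * R)‖ ≤ 1 := by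
  obtain ⟨K, -, h⟩ := exists_norm_sq_hilbertSchmidtVec_mul hT hT1 hR
  nlinarith [sq_nonneg ‖hilbertSchmidtVec p (K * R)‖, norm_nonneg (hilbertSchmidtVec p (T * R))]

/-- An observable that attains norm `1` squares to the identity on the support of the state. -/
theorem mul_mul_eq_of_norm_hilbertSchmidtVec_eq_one (hT : T.IsHermitian)
    (hT1 : (1 - T ^ 2).PosSemidef) (hR : (R * R.conjTranspose).trace = 1)
    (hnorm : ‖hilbertSchmidtVec p (T * R)‖ = 1) : T * (T * R) = R := by
  obtain ⟨K, hK, h⟩ := exists_norm_sq_hilbertSchmidtVec_mul hT hT1 hR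
  have h0 : hilbertSchmidtVec p (K * R) = 0 := by
    rw [hnorm] at h
    have : ‖hilbertSchmidtVec p (K * R)‖ ^ 2 = 0 := by linarith
    simpa using this
  have hKR : K * R = 0 := hilbertSchmidtVec_injective p (by rw [h0, map_zero])
  have h1 : (1 - T ^ 2) * R = 0 := by rw [← hK, mul_assoc, hKR, mul_zero]
  rw [← sub_eq_zero, ← neg_eq_zero, ← h1]
  noncomm_ring

end HilbertSchmidt

/-! ### Local operators acting on a purified state -/

theorem LinearMap.exists_section_on_range {K V W : Type*} [Field K] [AddCommGroup V] [Module K V]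
    [AddCommGroup W] [Module K W] (f : V →ₗ[K] W) :
    ∃ g : W →ₗ[K] V, ∀ w ∈ f.range, f (g w) = w := by
  obtain ⟨g₀, hg₀⟩ := f.rangeRestrict.exists_rightInverse_of_surjective f.range_rangeRestrict
  obtain ⟨g, hg⟩ := g₀.exists_extend
  refine ⟨g, fun w hw => ?_⟩
  have h1 : g w = g₀ ⟨w, hw⟩ := congrArg (fun φ => φ ⟨w, hw⟩) hg
  have h2 := congrArg (fun φ => ((φ ⟨w, hw⟩ : f.range) : W)) hg₀
  rw [h1]
  exact h2

section LocalAction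

variable {d : ℕ}

/-- The vector `(A ⊗ 1) R`, as a real-linear function of the operator `A` on the first factor. -/
noncomputable def leftAction (R : Matrix (Fin d × Fin d) (Fin d × Fin d) ℂ) :
    Matrix (Fin d) (Fin d) ℂ →ₗ[ℝ] EuclideanSpace ℂ ((Fin d × Fin d) × (Fin d × Fin d)) :=
  hilbertSchmidtVec _ ∘ₗ
    { toFun := fun A => (A ⊗ₖ (1 : Matrix (Fin d) (Fin d) ℂ)) * R
      map_add' := fun A B => by rw [Matrix.add_kronecker, add_mul]
      map_smul' := fun c A => by
        rw [Matrix.smul_kronecker, smul_mul_assoc, RingHom.id_apply] }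

/-- The vector `(1 ⊗ B) R`, as a real-linear function of the operator `B` on the second factor. -/
noncomputable def rightAction (R : Matrix (Fin d × Fin d) (Fin d × Fin d) ℂ) :
    Matrix (Fin d) (Fin d) ℂ →ₗ[ℝ] EuclideanSpace ℂ ((Fin d × Fin d) × (Fin d × Fin d)) :=
  hilbertSchmidtVec _ ∘ₗ
    { toFun := fun B => ((1 : Matrix (Fin d) (Fin d) ℂ) ⊗ₖ B) * R
      map_add' := fun A B => by rw [Matrix.kronecker_add, add_mul]
      map_smul' := fun c A => by
        rw [Matrix.kronecker_smul, smul_mul_assoc, RingHom.id_apply] }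

variable {R : Matrix (Fin d × Fin d) (Fin d × Fin d) ℂ}

theorem leftAction_apply (A : Matrix (Fin d) (Fin d) ℂ) :
    leftAction R A = hilbertSchmidtVec _ ((A ⊗ₖ (1 : Matrix (Fin d) (Fin d) ℂ)) * R) := rfl

theorem kronecker_one_mul_comm (A B : Matrix (Fin d) (Fin d) ℂ) :
    (A ⊗ₖ (1 : Matrix (Fin d) (Fin d) ℂ)) * (((1 : Matrix (Fin d) (Fin d) ℂ) ⊗ₖ B) * R)
      = ((1 : Matrix (Fin d) (Fin d) ℂ) ⊗ₖ B) * ((A ⊗ₖ (1 : Matrix (Fin d) (Fin d) ℂ)) * R) := by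
  rw [← mul_assoc, ← mul_assoc, ← Matrix.mul_kronecker_mul, ← Matrix.mul_kronecker_mul]
  simp

variable (R) in
/-- The support of the state on the first tensor factor: the span of the vectors
`a ↦ R (a, b) q` in `ℂ^d`. -/
def leftSupport : Submodule ℂ (Fin d → ℂ) :=
  Submodule.span ℂ
    (Set.range fun x : Fin d × (Fin d × Fin d) => fun a : Fin d => R (a, x.1) x.2)

theorem mulVec_column (A : Matrix (Fin d) (Fin d) ℂ) (b : Fin d) (q : Fin d × Fin d) :
    A.mulVec (fun a => R (a, b) q)
      = fun a => ((A ⊗ₖ (1 : Matrix (Fin d) (Fin d) ℂ)) * R) (a, b) q := by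
  ext a
  simp [Matrix.mulVec, dotProduct, Matrix.mul_apply, Matrix.kroneckerMap_apply,
    Fintype.sum_prod_type, Matrix.one_apply]

/-- The operator `B` on the second factor only mixes the spanning vectors of the support. -/
theorem mulVec_mem_leftSupport {A B : Matrix (Fin d) (Fin d) ℂ}
    (h : leftAction R A = rightAction R B) {w : Fin d → ℂ} (hw : w ∈ leftSupport R) :
    A.mulVec w ∈ leftSupport R := by
  have h' := hilbertSchmidtVec_injective _ h
  induction hw using Submodule.span_induction with
  | mem w hw =>
    obtain ⟨⟨b, q⟩, rfl⟩ := hw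
    have hcol : A.mulVec (fun a => R (a, b) q) = ∑ b', B b b' • fun a => R (a, b') q := by
      rw [mulVec_column]
      ext a
      refine (congrFun (congrFun h' (a, b)) q).trans ?_
      simp [Matrix.mul_apply, Matrix.kroneckerMap_apply, Fintype.sum_prod_type, Matrix.one_apply]
    rw [hcol]
    exact Submodule.sum_mem _ fun b' _ =>
      Submodule.smul_mem _ _ (Submodule.subset_span ⟨(b', q), rfl⟩)
  | zero => simp
  | add u v _ _ hu hv => rw [Matrix.mulVec_add]; exact Submodule.add_mem _ hu hv
  | smul c u _ hu => rw [Matrix.mulVec_smul]; exact Submodule.smul_mem _ _ hu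

theorem mulVec_eq_zero_of_leftAction_eq_zero {A : Matrix (Fin d) (Fin d) ℂ}
    (h : leftAction R A = 0) {w : Fin d → ℂ} (hw : w ∈ leftSupport R) : A.mulVec w = 0 := by
  have h' := hilbertSchmidtVec_injective _ (h.trans (map_zero _).symm)
  induction hw using Submodule.span_induction with
  | mem w hw =>
    obtain ⟨⟨b, q⟩, rfl⟩ := hw
    rw [mulVec_column]
    ext a
    exact congrFun (congrFun h' (a, b)) q
  | zero => simp
  | add u v _ _ hu hv => rw [Matrix.mulVec_add, hu, hv, add_zero]
  | smul c u _ hu => rw [Matrix.mulVec_smul, hu, smul_zero]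

theorem nontrivial_leftSupport (hR : R ≠ 0) : Nontrivial (leftSupport R) := by
  rw [Submodule.nontrivial_iff_ne_bot]
  intro hbot
  apply hR
  ext ⟨a, b⟩ q
  have h : (fun a => R (a, b) q) ∈ leftSupport R := Submodule.subset_span ⟨(b, q), rfl⟩
  rw [hbot, Submodule.mem_bot] at h
  exact congrFun h a

/-- Orthonormal vectors of a real space `S` represented by operators `X s` with
`X s X t + X t X s = 2 ⟪s, t⟫` on the support give anticommuting involutions of the support. -/
theorem two_pow_le_of_clifford_relations (hR : R ≠ 0) {H : Type*} [NormedAddCommGroup H]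
    [InnerProductSpace ℝ H] (S : Submodule ℝ H) [FiniteDimensional ℝ S]
    (X Y : H →ₗ[ℝ] Matrix (Fin d) (Fin d) ℂ)
    (hXY : ∀ s ∈ S, leftAction R (X s) = rightAction R (Y s))
    (hcliff : ∀ s ∈ S, ∀ t ∈ S,
      leftAction R (X s * X t + X t * X s - (2 * ⟪s, t⟫_ℝ) • 1) = 0)
    (k : ℕ) (hk : 2 * k ≤ Module.finrank ℝ S) : 2 ^ k ≤ d := by
  have := nontrivial_leftSupport hR
  let u : Fin (2 * k) → H := fun i => stdOrthonormalBasis ℝ S (Fin.castLE hk i)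
  have huS : ∀ i, u i ∈ S := fun i => Subtype.property _
  have huin : ∀ i j, ⟪u i, u j⟫_ℝ = if i = j then 1 else 0 := by
    intro i j
    have h := orthonormal_iff_ite.mp (stdOrthonormalBasis ℝ S).orthonormal
      (Fin.castLE hk i) (Fin.castLE hk j)
    simpa [u] using h
  have hrel : ∀ i j, ∀ w ∈ leftSupport R,
      (X (u i)).mulVec ((X (u j)).mulVec w) + (X (u j)).mulVec ((X (u i)).mulVec w)
        = (2 * ⟪u i, u j⟫_ℝ) • w := by
    intro i j w hw
    have h := mulVec_eq_zero_of_leftAction_eq_zero (hcliff _ (huS i) _ (huS j)) hw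
    rw [Matrix.sub_mulVec, Matrix.add_mulVec, Matrix.smul_mulVec, Matrix.one_mulVec,
      sub_eq_zero] at h
    rw [Matrix.mulVec_mulVec, Matrix.mulVec_mulVec, h]
  let e : Fin (2 * k) → Module.End ℂ (leftSupport R) := fun i =>
    (X (u i)).mulVecLin.restrict fun w hw => mulVec_mem_leftSupport (hXY _ (huS i)) hw
  have hdim := two_pow_le_finrank_of_anticommuting_involutions k (leftSupport R) e
    (fun i w => Subtype.ext ?_) (fun i j hij w => Subtype.ext ?_)
  · exact hdim.trans ((Submodule.finrank_le _).trans (by simp))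
  · have h := hrel i i w w.2
    rw [huin, if_pos rfl, mul_one, two_smul, ← two_smul ℝ, ← two_smul ℝ (w : Fin d → ℂ)] at h
    exact smul_right_injective _ (two_ne_zero (α := ℝ)) h
  · have h := hrel i j w w.2
    rw [huin, if_neg hij, mul_zero, zero_smul] at h
    exact eq_neg_of_add_eq_zero_left h

end LocalAction

/-! ### Clifford relations from extremality -/

namespace IsTensorProductRepresentation

variable {n m d : ℕ} {C : Matrix (Fin n) (Fin m) ℝ} {M : Fin n → Matrix (Fin d) (Fin d) ℂ}
  {N : Fin m → Matrix (Fin d) (Fin d) ℂ} {ρ R : Matrix (Fin d × Fin d) (Fin d × Fin d) ℂ}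

/-- The Hermitian operators on `ℂ^d ⊗ ℂ^d` given by the observables. -/
def observable (M : Fin n → Matrix (Fin d) (Fin d) ℂ) (N : Fin m → Matrix (Fin d) (Fin d) ℂ) :
    Fin n ⊕ Fin m → Matrix (Fin d × Fin d) (Fin d × Fin d) ℂ :=
  Sum.elim (fun i => M i ⊗ₖ 1) fun j => 1 ⊗ₖ N j

theorem isHermitian_observable (h : IsTensorProductRepresentation C M N ρ) (k : Fin n ⊕ Fin m) :
    (observable M N k).IsHermitian := by
  cases k with
  | inl i => simp [observable, Matrix.IsHermitian, Matrix.conjTranspose_kronecker,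
      (h.isHermitian_left i).eq]
  | inr j => simp [observable, Matrix.IsHermitian, Matrix.conjTranspose_kronecker,
      (h.isHermitian_right j).eq]

theorem sq_observable_le_one (h : IsTensorProductRepresentation C M N ρ) (k : Fin n ⊕ Fin m) :
    (1 - observable M N k ^ 2).PosSemidef := by
  cases k with
  | inl i =>
    have h1 := (h.sq_left_le_one i).kronecker (Matrix.PosSemidef.one (n := Fin d) (R := ℂ))
    have heq : 1 - observable M N (.inl i) ^ 2 = (1 - M i ^ 2) ⊗ₖ 1 := by
      rw [sub_eq_iff_eq_add, pow_two (observable M N _), observable, Sum.elim_inl,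
        ← Matrix.mul_kronecker_mul, mul_one, ← pow_two, ← Matrix.add_kronecker, sub_add_cancel,
        Matrix.one_kronecker_one]
    rw [heq]
    exact h1
  | inr j =>
    have h1 := (Matrix.PosSemidef.one (n := Fin d) (R := ℂ)).kronecker (h.sq_right_le_one j)
    have heq : 1 - observable M N (.inr j) ^ 2 = 1 ⊗ₖ (1 - N j ^ 2) := by
      rw [sub_eq_iff_eq_add, pow_two (observable M N _), observable, Sum.elim_inr,
        ← Matrix.mul_kronecker_mul, mul_one, ← pow_two, ← Matrix.kronecker_add, sub_add_cancel,
        Matrix.one_kronecker_one]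
    rw [heq]
    exact h1

/-- The vectors `(M i ⊗ 1) R` and `(1 ⊗ N j) R`, where `ρ = R Rᴴ`. -/
theorem isVectorRealization (h : IsTensorProductRepresentation C M N ρ)
    (hρ : R * R.conjTranspose = ρ) :
    IsVectorRealization C fun k => hilbertSchmidtVec _ (observable M N k * R) := by
  refine ⟨fun k => norm_hilbertSchmidtVec_mul_le_one (h.isHermitian_observable k)
    (h.sq_observable_le_one k) (by rw [hρ, h.state_trace]), fun i j => ?_⟩
  have hij : observable M N (.inl i) * observable M N (.inr j) = M i ⊗ₖ N j := by
    simp [observable, ← Matrix.mul_kronecker_mul]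
  rw [inner_hilbertSchmidtVec, Matrix.conjTranspose_mul, (h.isHermitian_observable _).eq,
    mul_assoc, Matrix.trace_mul_comm, ← mul_assoc, hij, mul_assoc, hρ, ← h.correlation,
    Complex.ofReal_re]

/-- For every `v` the symmetric form `⟪v, (X s X t + X t X s - 2 ⟪s, t⟫) R⟫` vanishes on the
diagonal at each vector of the realization, hence, by extremality, on all pairs from the left and
right families, and these span `S`. -/
theorem leftAction_clifford_eq_zero (h : IsTensorProductRepresentation C M N ρ)
    (hρ : R * R.conjTranspose = ρ) (hC : C ∈ (bipartiteCorrelations n m).extremePoints ℝ)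
    (hC0 : C ≠ 0)
    {z : Fin n ⊕ Fin m → EuclideanSpace ℂ ((Fin d × Fin d) × (Fin d × Fin d))}
    (hz : z = fun k => hilbertSchmidtVec _ (observable M N k * R))
    {X Y : EuclideanSpace ℂ ((Fin d × Fin d) × (Fin d × Fin d)) →ₗ[ℝ] Matrix (Fin d) (Fin d) ℂ}
    (hX : ∀ s ∈ Submodule.span ℝ (Set.range z), leftAction R (X s) = s)
    (hY : ∀ s ∈ Submodule.span ℝ (Set.range z), rightAction R (Y s) = s)
    {s t : EuclideanSpace ℂ ((Fin d × Fin d) × (Fin d × Fin d))}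
    (hs : s ∈ Submodule.span ℝ (Set.range z)) (ht : t ∈ Submodule.span ℝ (Set.range z)) :
    leftAction R (X s * X t + X t * X s - (2 * ⟪s, t⟫_ℝ) • 1) = 0 := by
  have hreal : IsVectorRealization C z := hz ▸ h.isVectorRealization hρ
  have hzS : ∀ k, z k ∈ Submodule.span ℝ (Set.range z) := fun k => Submodule.subset_span ⟨k, rfl⟩
  have hinvol : ∀ k, observable M N k * (observable M N k * R) = R := fun k =>
    mul_mul_eq_of_norm_hilbertSchmidtVec_eq_one (h.isHermitian_observable k)
      (h.sq_observable_le_one k) (by rw [hρ, h.state_trace])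
      (by simpa [hz] using hreal.norm_eq_one hC hC0 k)
  have hXR : ∀ k, (X (z k) ⊗ₖ (1 : Matrix (Fin d) (Fin d) ℂ)) * R = observable M N k * R :=
    fun k => hilbertSchmidtVec_injective _ ((hX _ (hzS k)).trans (congrFun hz k))
  have hYR : ∀ k, ((1 : Matrix (Fin d) (Fin d) ℂ) ⊗ₖ Y (z k)) * R = observable M N k * R :=
    fun k => hilbertSchmidtVec_injective _ ((hY _ (hzS k)).trans (congrFun hz k))
  -- Operators on different factors commute, so each factor of `X (z k) X (z k) R` can be
  -- exchanged for the observable by passing through the other factor.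
  have hXX : ∀ k, leftAction R (X (z k) * X (z k)) = leftAction R 1 := by
    intro k
    rw [leftAction_apply, leftAction_apply, Matrix.one_kronecker_one, one_mul]
    congr 1
    have hmul : (X (z k) * X (z k)) ⊗ₖ (1 : Matrix (Fin d) (Fin d) ℂ)
        = (X (z k) ⊗ₖ (1 : Matrix (Fin d) (Fin d) ℂ)) *
          (X (z k) ⊗ₖ (1 : Matrix (Fin d) (Fin d) ℂ)) := by
      rw [← Matrix.mul_kronecker_mul, one_mul]
    rw [hmul, mul_assoc, hXR k]
    cases k with
    | inl i =>
      rw [← hYR, kronecker_one_mul_comm, hXR]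
      refine Eq.trans (kronecker_one_mul_comm (M i) (Y (z (.inl i)))).symm ?_
      rw [hYR]
      exact hinvol (.inl i)
    | inr j =>
      refine Eq.trans (kronecker_one_mul_comm (X (z (.inr j))) (N j)) ?_
      rw [hXR]
      exact hinvol (.inr j)
  let Q := LinearMap.mk₂ ℝ (fun s t => leftAction R (X s * X t + X t * X s - (2 * ⟪s, t⟫_ℝ) • 1))
    (fun s s' t => by
      rw [← map_add, map_add X, inner_add_left]
      congr 1
      rw [mul_add 2, add_smul]
      noncomm_ring)
    (fun c s t => by
      rw [← map_smul, map_smul X, real_inner_smul_left, smul_sub, smul_add, smul_smul,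
        smul_mul_assoc, mul_smul_comm, mul_left_comm])
    (fun s t t' => by
      rw [← map_add, map_add X, inner_add_right]
      congr 1
      rw [mul_add 2, add_smul]
      noncomm_ring)
    (fun c s t => by
      rw [← map_smul, map_smul X, real_inner_smul_right, smul_sub, smul_add, smul_smul,
        smul_mul_assoc, mul_smul_comm, mul_left_comm])
  have hQ : ∀ s t, Q s t = leftAction R (X s * X t + X t * X s - (2 * ⟪s, t⟫_ℝ) • 1) :=
    fun _ _ => rfl
  have hQsymm : ∀ s t, Q s t = Q t s := fun s t => by
    rw [hQ, hQ, add_comm, real_inner_comm]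
  have hQdiag : ∀ k, Q (z k) (z k) = 0 := fun k => by
    rw [hQ, map_sub, map_add, map_smul, hXX, real_inner_self_eq_norm_sq,
      hreal.norm_eq_one hC hC0 k]
    module
  have hQz : ∀ i j, Q (z (.inl i)) (z (.inr j)) = 0 := fun i j => by
    refine ext_inner_left ℝ fun v => ?_
    rw [inner_zero_right]
    exact hreal.bilin_eq_zero hC (Q.compr₂ (innerₗ _ v)) (fun s t => by simp [hQsymm s t])
      (fun k => by simp [hQdiag k]) i j
  have hle : ∀ k, z k ∈ Submodule.span ℝ (Set.range fun i => z (.inl i)) ∧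
      z k ∈ Submodule.span ℝ (Set.range fun j => z (.inr j)) := by
    rintro (i | j)
    · exact ⟨Submodule.subset_span ⟨i, rfl⟩, hreal.inl_mem_span hC hC0 i⟩
    · exact ⟨hreal.inr_mem_span hC hC0 j, Submodule.subset_span ⟨j, rfl⟩⟩
  have hs' : s ∈ Submodule.span ℝ (Set.range fun i => z (.inl i)) :=
    Submodule.span_le.mpr (Set.range_subset_iff.mpr fun k => (hle k).1) hs
  have ht' : t ∈ Submodule.span ℝ (Set.range fun j => z (.inr j)) :=
    Submodule.span_le.mpr (Set.range_subset_iff.mpr fun k => (hle k).2) ht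
  rw [← hQ]
  clear hs ht
  induction hs', ht' using Submodule.span_induction₂ with
  | mem_mem s t hs ht =>
    obtain ⟨i, rfl⟩ := hs
    obtain ⟨j, rfl⟩ := ht
    exact hQz i j
  | zero_left => simp
  | zero_right => simp
  | add_left _ _ _ _ _ _ h1 h2 => rw [map_add, LinearMap.add_apply, h1, h2, add_zero]
  | add_right _ _ _ _ _ _ h1 h2 => rw [map_add, h1, h2, add_zero]
  | smul_left _ _ _ _ _ h1 => rw [map_smul, LinearMap.smul_apply, h1, smul_zero]
  | smul_right _ _ _ _ _ h1 => rw [map_smul, h1, smul_zero]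

end IsTensorProductRepresentation

theorem theorem1p3 (n m : ℕ) (C : Matrix (Fin n) (Fin m) ℝ)
    (hC : C ∈ (bipartiteCorrelations n m).extremePoints ℝ)
    (d : ℕ) (M : Fin n → Matrix (Fin d) (Fin d) ℂ) (N : Fin m → Matrix (Fin d) (Fin d) ℂ)
    (ρ : Matrix (Fin d × Fin d) (Fin d × Fin d) ℂ)
    (hrep : IsTensorProductRepresentation C M N ρ) :
    2 ^ (C.rank / 2) ≤ d := by
  obtain ⟨K, hK⟩ := hrep.state_posSemidef.exists_conjTranspose_mul_self
  set R := K.conjTranspose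
  have hρ : R * R.conjTranspose = ρ := by rw [← hK, Matrix.conjTranspose_conjTranspose]
  have hR0 : R ≠ 0 := by
    rintro hR
    have h := hrep.state_trace
    rw [← hρ, hR] at h
    simp at h
  rcases eq_or_ne C 0 with rfl | hC0
  · have hd : d ≠ 0 := by
      rintro rfl
      exact hR0 (Subsingleton.elim _ _)
    simpa using Nat.one_le_iff_ne_zero.mpr hd
  let z := fun k => hilbertSchmidtVec _ (IsTensorProductRepresentation.observable M N k * R)
  have hreal : IsVectorRealization C z := hrep.isVectorRealization hρ
  obtain ⟨X, hX⟩ := (leftAction R).exists_section_on_range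
  obtain ⟨Y, hY⟩ := (rightAction R).exists_section_on_range
  -- Both local algebras reach the whole span of the realization, since the span of either family
  -- contains the other.
  have hSl : Submodule.span ℝ (Set.range z) ≤ (leftAction R).range := by
    have hl : Submodule.span ℝ (Set.range fun i => z (.inl i)) ≤ (leftAction R).range :=
      Submodule.span_le.mpr (Set.range_subset_iff.mpr fun i => ⟨M i, rfl⟩)
    refine Submodule.span_le.mpr (Set.range_subset_iff.mpr ?_)
    rintro (i | j)
    · exact hl (Submodule.subset_span ⟨i, rfl⟩)
    · exact hl (hreal.inr_mem_span hC hC0 j)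
  have hSr : Submodule.span ℝ (Set.range z) ≤ (rightAction R).range := by
    have hr : Submodule.span ℝ (Set.range fun j => z (.inr j)) ≤ (rightAction R).range :=
      Submodule.span_le.mpr (Set.range_subset_iff.mpr fun j => ⟨N j, rfl⟩)
    refine Submodule.span_le.mpr (Set.range_subset_iff.mpr ?_)
    rintro (i | j)
    · exact hr (hreal.inl_mem_span hC hC0 i)
    · exact hr (Submodule.subset_span ⟨j, rfl⟩)
  refine two_pow_le_of_clifford_relations hR0 (Submodule.span ℝ (Set.range z)) X Y
    (fun s hs => (hX s (hSl hs)).trans (hY s (hSr hs)).symm)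
    (fun s hs t ht => hrep.leftAction_clifford_eq_zero hρ hC hC0 rfl
      (fun s hs => hX s (hSl hs)) (fun s hs => hY s (hSr hs)) hs ht) _ ?_
  exact (Nat.mul_div_le _ 2).trans hreal.rank_le_finrank_span
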